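/- For a finite abelian group $G$ (written additively), a finite sequence $S=(g_1,\dots,g_l)$ of elements of $G$ is called zero-sumfree if $\sum_{i\in I} g_i\neq 0$ for every nonempty $I\subseteq\{1,\dots,l\}$ (in particular the empty sequence is zero-sumfree). The cross number of $S$ is $\mathsf{k}(S)=\sum_{i=1}^{l}\frac{1}{\mathrm{ord}(g_i)}$, and the little cross number of $G$ is $$\mathsf{k}(G)=\max\{\mathsf{k}(S) : S \text{ a zero-sumfree sequence of } G\}.$$ For an integer $n\ge 1$ let $\omega(n)$ be the number of distinct prime divisors of $n$, let $P^-(n)$ be the smallest prime divisor of $n$ if $n>1$, and let $P^-(1)=1$. Put $$\alpha(n)=\sum_{d\mid n}\frac{P^-(d)-1}{d},\qquad \beta(n)=\sum_{\substack{d\mid n\\ d\text{ prime}}}\frac{P^-(d)-1}{d},$$ the sums being over positive divisors, and let $$d_1=\frac{166822111}{109486080}\approx 1.5237,\qquad d_2=\frac{1784073894563}{476759162880}\approx 3.7421.$$ Let $C_n$ denote the cyclic group of order $n$. Then: (i) For every integer $n\ge 1$ and every cyclic group $G\simeq C_n$, $$\mathsf{k}(G)\le\alpha(n)\le d_1\,\omega(n).$$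 (ii) For all integers $m,n\ge 1$ with $1<m$ and $m\mid n$, and every finite abelian group $G\simeq C_m\oplus C_n$, $$\mathsf{k}(G)\le 3\alpha(n)-\beta(n)\le d_2\,\omega(n).$$ -/

import Mathlib

noncomputable section

/-- The sumset of a (finite, unordered) sequence `S`: the sums of its nonempty subsequences. -/
def sumset {G : Type*} [AddCommGroup G] (S : Multiset G) : Set G :=
  {s | ∃ T : Multiset G, T ≤ S ∧ T ≠ 0 ∧ T.sum = s}

/-- A sequence is zero-sumfree if `0` is not the sum of a nonempty subsequence. -/
def IsZeroSumFree {G : Type*} [AddCommGroup G] (S : Multiset G) : Prop :=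
  (0 : G) ∉ sumset S

/-- The cross number of a sequence: the sum of the inverses of the orders of its terms. -/
def crossNumber {G : Type*} [AddCommGroup G] (S : Multiset G) : ℝ :=
  (S.map fun g => (1 : ℝ) / (addOrderOf g : ℝ)).sum

/-- The little cross number of `G`: the maximal cross number of a zero-sumfree sequence of `G`.
For finite `G` the supremum is a maximum, see `isGreatest_littleCrossNumber`. -/
def littleCrossNumber (G : Type*) [AddCommGroup G] : ℝ :=
  sSup {x : ℝ | ∃ S : Multiset G, IsZeroSumFree S ∧ crossNumber S = x}

/-- `α(n)`, the sum over the divisors `d` of `n` of `(P⁻(d) - 1) / d`, where `P⁻(d)` is the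
smallest prime factor of `d`, and `P⁻(1) = 1` (this is `Nat.minFac`). -/
def alphaFun (n : ℕ) : ℝ :=
  ∑ d ∈ n.divisors, ((d.minFac : ℝ) - 1) / (d : ℝ)

/-- `β(n)`, the same sum restricted to the prime divisors of `n`. -/
def betaFun (n : ℕ) : ℝ :=
  ∑ d ∈ n.divisors with d.Prime, ((d.minFac : ℝ) - 1) / (d : ℝ)

/-- In a finite abelian group there are finitely many zero-sumfree sequences. -/
theorem finite_isZeroSumFree (G : Type*) [AddCommGroup G] [Finite G] :
    {S : Multiset G | IsZeroSumFree S}.Finite := by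
  classical
  have := Fintype.ofFinite G
  refine (Set.finite_Iic (Nat.card G • (Finset.univ : Finset G).val)).subset ?_
  intro S hS
  rw [Set.mem_Iic, Multiset.le_iff_count]
  intro g
  rw [Multiset.count_nsmul, Multiset.count_univ, mul_one]
  by_contra! h
  refine hS ⟨Multiset.replicate (Nat.card G) g, ?_, ?_, ?_⟩
  · exact Multiset.le_count_iff_replicate_le.1 h.le
  · intro h0
    have h1 := congrArg Multiset.card h0
    simp at h1
  · rw [Multiset.sum_replicate]
    exact card_nsmul_eq_zero'

/-- The supremum that defines the little cross number of a finite abelian group is attained. -/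
theorem isGreatest_littleCrossNumber (G : Type*) [AddCommGroup G] [Finite G] :
    IsGreatest {x : ℝ | ∃ S : Multiset G, IsZeroSumFree S ∧ crossNumber S = x}
      (littleCrossNumber G) := by
  have hfin : {x : ℝ | ∃ S : Multiset G, IsZeroSumFree S ∧ crossNumber S = x}.Finite :=
    (finite_isZeroSumFree G).image crossNumber
  have hne : {x : ℝ | ∃ S : Multiset G, IsZeroSumFree S ∧ crossNumber S = x}.Nonempty := by
    refine ⟨_, 0, ?_, rfl⟩
    rintro ⟨T, hT, hT0, -⟩
    exact hT0 (le_antisymm hT (Multiset.zero_le T))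
  exact ⟨hne.csSup_mem hfin, fun x hx => le_csSup hfin.bddAbove hx⟩

end

/-!
The upper bounds for `k(G)` come from an exchange argument. Among the zero-sumfree sequences of
maximal cross number, take one of minimal length. Let `d > 1` and `p = P⁻(d)`. Suppose that at most
`p` of its terms of order `d` have a sum of order dividing `d / p`. Replacing them by their sum
keeps the sequence zero-sumfree, shortens it, and does not decrease the cross number, as
`1 / (d / p) = p / d`: a contradiction. So the number of terms of order `d` is bounded by a
constant of the elementary abelian `p`-group `G[p]`, into which the elements of order `d` are
mapped by multiplication by `d / p` (`littleCrossNumber_le_sum_divisors`,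
`exists_le_nsmul_sum_eq_zero`).

For `G` cyclic, `p` terms suffice to find such a subsequence. In rank two, `3 p - 2` terms suffice
(`exists_short_zero_sum_of_finrank_le_two`), and for `d = p` already `2 p - 1` do, since then every
zero-sum subsequence is a contradiction. These constants rest on Olson's bound
`D(C_p ^ r) ≤ r (p - 1) + 1`, a consequence of the Chevalley–Warning theorem
(`exists_zero_sum_coord`). Summing over `d` gives `α(n)` and `3 α(n) - β(n)`.

For the numerical bounds, write `n = m * p ^ a` with `p` the largest prime factor of `n`. Then
`α(n) ≤ α(m) p / (p - 1) + 1` (`alphaFun_mul_pow_le`), so `α(n)` is at most the value `A_k` that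
this recursion yields for the first `k = ω(n)` prime numbers. Likewise `β(n)` is at least
`k - ∑ i < k, 1 / p_i`. The resulting ratios to `k` are computed up to `k = 9`. Beyond, the linear
bounds are propagated by induction (`alphaSup_le`, `three_alphaSup_le`), because the prime numbers
greater than `3` are prime to `6` and hence grow by at least `6` every two steps.
-/

/-! ### Zero-sum subsequences over elementary abelian groups -/

/-- Olson's bound `D(C_p ^ r) ≤ r (p - 1) + 1`, in coordinates: the Chevalley–Warning theorem
for the polynomials `∑ i, v i k * X i ^ (p - 1)`. The support of a nontrivial common zero is the
required subsequence, as `x ^ (p - 1)` is the indicator of `x ≠ 0`. -/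
theorem exists_zero_sum_coord {p : ℕ} [Fact p.Prime] {ι κ : Type*} [Fintype ι] [Fintype κ]
    (v : ι → κ → ZMod p) (h : Fintype.card κ * (p - 1) < Fintype.card ι) :
    ∃ s : Finset ι, s.Nonempty ∧ ∑ i ∈ s, v i = 0 := by
  classical
  have hp : p.Prime := Fact.out
  have hp1 : p - 1 ≠ 0 := by have := hp.two_le; omega
  let f : κ → MvPolynomial ι (ZMod p) := fun k =>
    ∑ i, MvPolynomial.C (v i k) * MvPolynomial.X i ^ (p - 1)
  have hdeg : ∀ k, (f k).totalDegree ≤ p - 1 := fun k => by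
    refine MvPolynomial.totalDegree_finsetSum_le fun i _ => ?_
    refine (MvPolynomial.totalDegree_mul _ _).trans ?_
    rw [MvPolynomial.totalDegree_C, MvPolynomial.totalDegree_X_pow, zero_add]
  have hsum : (∑ k, (f k).totalDegree) < Fintype.card ι := by
    refine lt_of_le_of_lt (Finset.sum_le_sum fun k _ => hdeg k) ?_
    simpa using h
  have hev : ∀ x k, MvPolynomial.eval x (f k) = ∑ i, v i k * x i ^ (p - 1) := by
    intro x k
    simp [f]
  have hdvd := char_dvd_card_solutions_of_fintype_sum_lt p hsum
  let z : {x : ι → ZMod p // ∀ k, MvPolynomial.eval x (f k) = 0} :=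
    ⟨0, fun k => by rw [hev]; simp [hp1]⟩
  have hcard : 1 < Fintype.card {x : ι → ZMod p // ∀ k, MvPolynomial.eval x (f k) = 0} :=
    hp.one_lt.trans_le (Nat.le_of_dvd (Fintype.card_pos_iff.2 ⟨z⟩) hdvd)
  obtain ⟨⟨x, hx⟩, hxz⟩ := Fintype.exists_ne_of_one_lt_card hcard z
  have hx0 : x ≠ 0 := fun h0 => hxz (Subtype.ext h0)
  refine ⟨Finset.univ.filter fun i => x i ≠ 0, ?_, ?_⟩
  · obtain ⟨i, hi⟩ := Function.ne_iff.1 hx0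
    exact ⟨i, by simpa using hi⟩
  · funext k
    have := hx k
    rw [hev] at this
    rw [Finset.sum_apply, Finset.sum_filter, Pi.zero_apply]
    refine (Finset.sum_congr rfl fun i _ => ?_).trans this
    by_cases hi : x i = 0
    · simp [hi, hp1]
    · rw [if_pos hi, ZMod.pow_card_sub_one_eq_one hi, mul_one]

theorem exists_zero_sum_of_finrank {p : ℕ} [Fact p.Prime] {V ι : Type*} [AddCommGroup V]
    [Module (ZMod p) V] [Module.Finite (ZMod p) V] (v : ι → V) (s : Finset ι)
    (h : Module.finrank (ZMod p) V * (p - 1) < s.card) :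
    ∃ t ⊆ s, t.Nonempty ∧ ∑ i ∈ t, v i = 0 := by
  classical
  let b := Module.finBasis (ZMod p) V
  obtain ⟨t, ht, hsum⟩ := exists_zero_sum_coord (p := p) (fun i : s => b.equivFun (v i))
    (by simpa using h)
  refine ⟨t.map (Function.Embedding.subtype _), ?_, by simpa using ht, ?_⟩
  · intro i hi
    simp only [Finset.mem_map, Function.Embedding.coe_subtype] at hi
    obtain ⟨j, -, rfl⟩ := hi
    exact j.2
  · rw [Finset.sum_map, ← b.equivFun.map_eq_zero_iff, map_sum]
    exact hsum

theorem exists_short_zero_sum_of_finrank_le_one {p : ℕ} [Fact p.Prime] {V ι : Type*}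
    [AddCommGroup V] [Module (ZMod p) V] [Module.Finite (ZMod p) V]
    (hV : Module.finrank (ZMod p) V ≤ 1) (v : ι → V) (s : Finset ι) (h : p - 1 < s.card) :
    ∃ t ⊆ s, t.Nonempty ∧ t.card ≤ p ∧ ∑ i ∈ t, v i = 0 := by
  have hp : p.Prime := Fact.out
  have hp2 := hp.two_le
  obtain ⟨s', hs', hc⟩ := Finset.exists_subset_card_eq (show p ≤ s.card by omega)
  obtain ⟨t, ht, hne, hsum⟩ := exists_zero_sum_of_finrank (p := p) v s' (by
    nlinarith [Nat.sub_add_cancel hp.one_le])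
  exact ⟨t, ht.trans hs', hne, (Finset.card_le_card ht).trans hc.le, hsum⟩

/-- The bound `η(C_p ^ 2) ≤ 3 p - 2`. Attaching a further coordinate `1` to each of `3 p - 2`
vectors makes the length of a zero-sum subsequence a multiple of `p`, so `p` or `2 p`. In the
second case, it splits into two zero-sum subsequences, by Olson's bound for `2 p - 1` of its
terms; one of the two has length at most `p`. -/
theorem exists_short_zero_sum_of_finrank_le_two {p : ℕ} [Fact p.Prime] {V ι : Type*}
    [AddCommGroup V] [Module (ZMod p) V] [Module.Finite (ZMod p) V]
    (hV : Module.finrank (ZMod p) V ≤ 2) (v : ι → V) (s : Finset ι) (h : 3 * (p - 1) < s.card) :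
    ∃ t ⊆ s, t.Nonempty ∧ t.card ≤ p ∧ ∑ i ∈ t, v i = 0 := by
  classical
  have hp : p.Prime := Fact.out
  have hp2 := hp.two_le
  obtain ⟨s', hs', hc⟩ := Finset.exists_subset_card_eq (show 3 * (p - 1) + 1 ≤ s.card by omega)
  have hfr : Module.finrank (ZMod p) (V × ZMod p) ≤ 3 := by
    rw [Module.finrank_prod, Module.finrank_self]; omega
  obtain ⟨t, ht, hne, hsum⟩ := exists_zero_sum_of_finrank (p := p)
    (fun i => ((v i, 1) : V × ZMod p)) s'
    (by have := Nat.mul_le_mul_right (p - 1) hfr; omega)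
  have hsum1 : ∑ i ∈ t, v i = 0 := by simpa [Prod.fst_sum] using congrArg Prod.fst hsum
  have hsum2 : ((t.card : ℕ) : ZMod p) = 0 := by simpa [Prod.snd_sum] using congrArg Prod.snd hsum
  obtain ⟨c, hcard⟩ := (ZMod.natCast_eq_zero_iff _ _).1 hsum2
  have htle := Finset.card_le_card ht
  have hc3 : c < 3 := by
    by_contra! h3
    have := Nat.mul_le_mul_left p h3
    omega
  by_cases hle : t.card ≤ p
  · exact ⟨t, ht.trans hs', hne, hle, hsum1⟩
  have hc2 : t.card = p * 2 := by
    interval_cases c <;> omega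
  obtain ⟨i, hi⟩ := hne
  obtain ⟨u, hu, hune, husum⟩ := exists_zero_sum_of_finrank (p := p) v (t.erase i) (by
    rw [Finset.card_erase_of_mem hi]
    have := Nat.mul_le_mul_right (p - 1) hV
    omega)
  have hut : u ⊆ t := hu.trans (Finset.erase_subset _ _)
  by_cases hup : u.card ≤ p
  · exact ⟨u, hut.trans (ht.trans hs'), hune, hup, husum⟩
  refine ⟨t \ u, Finset.sdiff_subset.trans (ht.trans hs'), ⟨i, ?_⟩, ?_, ?_⟩
  · exact Finset.mem_sdiff.2 ⟨hi, fun h' => Finset.notMem_erase i t (hu h')⟩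
  · rw [Finset.card_sdiff_of_subset hut]; omega
  · have := Finset.sum_sdiff (f := v) hut
    rwa [husum, add_zero, hsum1] at this

/-! ### Elements of prime order -/

/-- The inequality `|G[p]| ≤ p ^ r` bounds the dimension of the vector space `G[p]` by `r`. -/
theorem finrank_torsionBy_le {G : Type*} [AddCommGroup G] [Finite G] {p r : ℕ} [Fact p.Prime]
    (h : Nat.card (AddSubgroup.torsionBy G p) ≤ p ^ r) :
    let _ := AddSubgroup.torsionBy.zmodModule (A := G) (n := p)
    Module.finrank (ZMod p) (AddSubgroup.torsionBy G p) ≤ r := by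
  let _ := AddSubgroup.torsionBy.zmodModule (A := G) (n := p)
  have hp : p.Prime := Fact.out
  have := Module.natCard_eq_pow_finrank (K := ZMod p) (V := AddSubgroup.torsionBy G p)
  rw [Nat.card_zmod] at this
  rw [this] at h
  exact (Nat.pow_le_pow_iff_right hp.one_lt).1 h

/-- Multiplication by `k` embeds the `p k`-torsion modulo the `k`-torsion into `G[p]`. So a
property of sequences over `G[p]` applies to sequences over the `p k`-torsion of `G`, with
sums in the `k`-torsion in place of zero sums. -/
theorem exists_le_nsmul_sum_eq_zero {G : Type*} [AddCommGroup G] {p k N M : ℕ}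
    (key : ∀ (ι : Type) (v : ι → AddSubgroup.torsionBy G p) (s : Finset ι), N < s.card →
      ∃ t ⊆ s, t.Nonempty ∧ t.card ≤ M ∧ ∑ i ∈ t, v i = 0)
    (U : Multiset G) (hU : ∀ g ∈ U, (p * k) • g = 0) (hcard : N < U.card) :
    ∃ T ≤ U, T ≠ 0 ∧ T.card ≤ M ∧ k • T.sum = 0 := by
  induction U using Quotient.inductionOn with
  | _ l =>
    have hl : ((Finset.univ : Finset (Fin l.length)).val.map l.get) = (l : Multiset G) := by
      rw [Fin.univ_val_map, List.ofFn_get]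
    obtain ⟨t, -, hne, htM, hsum⟩ := key (Fin l.length)
      (fun i => ⟨k • l.get i, AddSubgroup.torsionBy.nsmul_iff.2 (by
        rw [← mul_nsmul']
        exact hU _ (List.get_mem l i))⟩) Finset.univ (by simpa using hcard)
    refine ⟨t.val.map l.get, ?_, ?_, by simpa using htM, ?_⟩
    · exact (Multiset.map_le_map (Finset.val_le_iff.2 (Finset.subset_univ t))).trans hl.le
    · simpa using hne.ne_empty
    · have := congrArg Subtype.val hsum
      simp only [AddSubgroup.val_finsetSum, AddSubgroup.coe_zero] at this
      rw [← this, ← Finset.smul_sum]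
      rfl

/-! ### Exchanging a subsequence for its sum -/

theorem IsZeroSumFree.sum_cons_sub {G : Type*} [AddCommGroup G] [DecidableEq G] {S T : Multiset G}
    (hS : IsZeroSumFree S) (hT : T ≤ S) (hT0 : T ≠ 0) : IsZeroSumFree (T.sum ::ₘ (S - T)) := by
  rintro ⟨U, hU, hU0, hsum⟩
  by_cases hmem : T.sum ∈ U
  · obtain ⟨W, rfl⟩ := Multiset.exists_cons_of_mem hmem
    refine hS ⟨T + W, ?_, by simp [hT0], by simpa using hsum⟩
    rw [← add_tsub_cancel_of_le hT]
    exact add_le_add_right ((Multiset.cons_le_cons_iff _).1 hU) _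
  · exact hS ⟨U, ((Multiset.le_cons_of_notMem hmem).1 hU).trans tsub_le_self, hU0, hsum⟩

theorem crossNumber_cons {G : Type*} [AddCommGroup G] (g : G) (S : Multiset G) :
    crossNumber (g ::ₘ S) = 1 / (addOrderOf g : ℝ) + crossNumber S := by
  simp [crossNumber]

theorem crossNumber_add {G : Type*} [AddCommGroup G] (S T : Multiset G) :
    crossNumber (S + T) = crossNumber S + crossNumber T := by
  simp [crossNumber]

theorem crossNumber_of_forall_addOrderOf_eq {G : Type*} [AddCommGroup G] {d : ℕ} {S : Multiset G}
    (h : ∀ g ∈ S, addOrderOf g = d) : crossNumber S = S.card / (d : ℝ) := by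
  have : S.map (fun g => (1 : ℝ) / (addOrderOf g : ℝ)) = S.map fun _ => (1 : ℝ) / (d : ℝ) :=
    Multiset.map_congr rfl fun g hg => by rw [h g hg]
  rw [crossNumber, this, Multiset.map_const', Multiset.sum_replicate, nsmul_eq_mul, mul_one_div]

theorem crossNumber_eq_sum_divisors {G : Type*} [AddCommGroup G] {n : ℕ} (hn : n ≠ 0)
    (hG : ∀ g : G, n • g = 0) (S : Multiset G) :
    crossNumber S =
      ∑ d ∈ n.divisors, ((S.filter fun g => addOrderOf g = d).card : ℝ) / (d : ℝ) := by
  induction S using Multiset.induction_on with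
  | empty => simp [crossNumber]
  | cons g S ih =>
    rw [crossNumber_cons, ih, add_comm]
    have hmem : addOrderOf g ∈ n.divisors :=
      Nat.mem_divisors.2 ⟨addOrderOf_dvd_of_nsmul_eq_zero (hG g), hn⟩
    rw [← Finset.sum_ite_eq n.divisors (addOrderOf g) (fun d => 1 / (d : ℝ)) |>.trans (if_pos hmem),
      ← Finset.sum_add_distrib]
    refine Finset.sum_congr rfl fun d _ => ?_
    by_cases hd : addOrderOf g = d
    · rw [Multiset.filter_cons_of_pos (p := fun g => addOrderOf g = d) _ hd, Multiset.card_cons,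
        if_pos hd]
      push_cast
      ring
    · rw [Multiset.filter_cons_of_neg (p := fun g => addOrderOf g = d) _ hd, if_neg hd, add_zero]

/-- Among the zero-sumfree sequences of maximal cross number, take one of minimal length. If it
had more than `f d` terms of order `d`, some of them would sum to zero, which is excluded, or at
most `P⁻(d)` of them would have a sum of order dividing `d / P⁻(d)`. Exchanging these terms for their sum yields a shorter zero-sumfree sequence, whose
cross number is at least as large. -/
theorem littleCrossNumber_le_sum_divisors {G : Type*} [AddCommGroup G] [Finite G] {n : ℕ}
    (hn : n ≠ 0) (hG : ∀ g : G, n • g = 0) (f : ℕ → ℕ)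
    (hf : ∀ d : ℕ, d ≠ 1 → ∀ U : Multiset G, (∀ g ∈ U, addOrderOf g = d) → f d < U.card →
      ∃ T ≤ U, T ≠ 0 ∧ (T.sum = 0 ∨ T.card ≤ d.minFac ∧ (d / d.minFac) • T.sum = 0)) :
    littleCrossNumber G ≤ ∑ d ∈ n.divisors, (f d : ℝ) / (d : ℝ) := by
  classical
  obtain ⟨hmax, hub⟩ := isGreatest_littleCrossNumber G
  obtain ⟨S, ⟨hS, hSk⟩, hmin⟩ : ∃ S : Multiset G,
      (IsZeroSumFree S ∧ crossNumber S = littleCrossNumber G) ∧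
      ∀ S' : Multiset G, IsZeroSumFree S' → crossNumber S' = littleCrossNumber G →
        S.card ≤ S'.card := by
    have hex : ∃ N, ∃ S : Multiset G,
      (IsZeroSumFree S ∧ crossNumber S = littleCrossNumber G) ∧ S.card = N := by
      obtain ⟨S, hS⟩ := hmax
      exact ⟨_, S, hS, rfl⟩
    obtain ⟨S, hS, hc⟩ := Nat.find_spec hex
    exact ⟨S, hS, fun S' h1 h2 => hc ▸ Nat.find_min' hex ⟨S', ⟨h1, h2⟩, rfl⟩⟩
  rw [← hSk, crossNumber_eq_sum_divisors hn hG]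
  refine Finset.sum_le_sum fun d hd => ?_
  have hd0 : 0 < d := Nat.pos_of_mem_divisors hd
  refine div_le_div_of_nonneg_right ?_ (Nat.cast_nonneg d)
  rw [Nat.cast_le]
  by_contra! hlt
  have hU : ∀ g ∈ S.filter fun g => addOrderOf g = d, addOrderOf g = d :=
    fun g hg => (Multiset.mem_filter.1 hg).2
  have hUS : S.filter (fun g => addOrderOf g = d) ≤ S := Multiset.filter_le _ _
  by_cases hd1 : d = 1
  · -- a zero-sumfree sequence has no term of order `1`
    obtain ⟨g, hg⟩ := Multiset.card_pos_iff_exists_mem.1 (Nat.zero_lt_of_lt hlt)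
    have hg0 : g = 0 := AddMonoid.addOrderOf_eq_one_iff.1 ((hU g hg).trans hd1)
    exact hS ⟨{g}, Multiset.singleton_le.2 (Multiset.mem_of_le hUS hg), by simp, by simpa using hg0⟩
  obtain ⟨T, hTU, hT0, hT⟩ := hf d hd1 _ hU hlt
  have hTS := hTU.trans hUS
  have hTsum : T.sum ≠ 0 := fun h => hS ⟨T, hTS, hT0, h⟩
  obtain ⟨hTp, hTd⟩ := hT.resolve_left hTsum
  have hp := Nat.minFac_prime hd1
  have hord : ∀ g ∈ T, addOrderOf g = d := fun g hg => hU g (Multiset.mem_of_le hTU hg)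
  have hdp : 0 < d / d.minFac := Nat.div_pos (Nat.minFac_le hd0) hp.pos
  have hS' := hS.sum_cons_sub hTS hT0
  have hsplit : crossNumber S = crossNumber T + crossNumber (S - T) := by
    rw [← crossNumber_add, add_tsub_cancel_of_le hTS]
  have hTk : crossNumber T = T.card / (d : ℝ) := crossNumber_of_forall_addOrderOf_eq hord
  have hσle : addOrderOf T.sum ≤ d / d.minFac :=
    Nat.le_of_dvd hdp (addOrderOf_dvd_of_nsmul_eq_zero hTd)
  have hσpos : 0 < addOrderOf T.sum := addOrderOf_pos _
  have hσ : (T.card : ℝ) / d ≤ 1 / (addOrderOf T.sum : ℝ) := by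
    have hd0' : (0 : ℝ) < d := by exact_mod_cast hd0
    have hσpos' : (0 : ℝ) < addOrderOf T.sum := by exact_mod_cast hσpos
    rw [div_le_div_iff₀ hd0' hσpos', one_mul]
    have : T.card * addOrderOf T.sum ≤ d :=
      (Nat.mul_le_mul hTp hσle).trans (Nat.mul_div_le d d.minFac)
    exact_mod_cast this
  have hk' : crossNumber (T.sum ::ₘ (S - T)) = littleCrossNumber G := by
    refine le_antisymm (hub ⟨_, hS', rfl⟩) ?_
    rw [crossNumber_cons, ← hSk, hsplit, hTk]
    linarith
  have hle := hmin _ hS' hk'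
  rw [Multiset.card_cons, Multiset.card_sub hTS] at hle
  have hTc : T.card ≤ S.card := Multiset.card_le_card hTS
  have hT1 : T.card = 1 := by
    have := Multiset.card_pos.2 hT0
    omega
  -- a single term of order `d` is not in the `d / P⁻(d)`-torsion
  obtain ⟨g, rfl⟩ := Multiset.card_eq_one.1 hT1
  rw [Multiset.sum_singleton, hord g (by simp)] at hσle
  exact (Nat.div_lt_self hd0 hp.one_lt).not_ge hσle

/-! ### Groups with small `p`-torsion -/

theorem card_torsionBy_zmod_le {n p : ℕ} (hn : n ≠ 0) (hp : p ≠ 0) :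
    Nat.card (AddSubgroup.torsionBy (ZMod n) p) ≤ p := by
  classical
  have : NeZero n := ⟨hn⟩
  have h := IsAddCyclic.card_nsmul_eq_zero_le (α := ZMod n) (Nat.pos_of_ne_zero hp)
  rw [← Fintype.card_subtype, ← Nat.card_eq_fintype_card] at h
  refine (Nat.card_congr (Equiv.subtypeEquivRight fun x => ?_)).trans_le h
  exact AddSubgroup.torsionBy.nsmul_iff

theorem card_torsionBy_le_of_injective {G H : Type*} [AddCommGroup G] [AddCommGroup H] [Finite H]
    (e : G →+ H) (he : Function.Injective e) (p : ℕ) :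
    Nat.card (AddSubgroup.torsionBy G p) ≤ Nat.card (AddSubgroup.torsionBy H p) := by
  refine Nat.card_le_card_of_injective
    (fun x => (⟨e x, AddSubgroup.torsionBy.nsmul_iff.2 ?_⟩ : AddSubgroup.torsionBy H p)) ?_
  · rw [← map_nsmul, AddSubgroup.torsionBy.nsmul_iff.1 x.2, map_zero]
  · intro x y hxy
    exact Subtype.ext (he (congrArg Subtype.val hxy))

theorem card_torsionBy_prod_le {G H : Type*} [AddCommGroup G] [AddCommGroup H] [Finite G]
    [Finite H] (p : ℕ) : Nat.card (AddSubgroup.torsionBy (G × H) p) ≤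
      Nat.card (AddSubgroup.torsionBy G p) * Nat.card (AddSubgroup.torsionBy H p) := by
  rw [← Nat.card_prod]
  refine Nat.card_le_card_of_injective (fun x =>
    ((⟨x.1.1, AddSubgroup.torsionBy.nsmul_iff.2 ?_⟩,
      ⟨x.1.2, AddSubgroup.torsionBy.nsmul_iff.2 ?_⟩) :
      AddSubgroup.torsionBy G p × AddSubgroup.torsionBy H p)) ?_
  · exact congrArg Prod.fst (AddSubgroup.torsionBy.nsmul_iff.1 x.2)
  · exact congrArg Prod.snd (AddSubgroup.torsionBy.nsmul_iff.1 x.2)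
  · intro x y hxy
    rw [Prod.mk.injEq, Subtype.mk.injEq, Subtype.mk.injEq] at hxy
    exact Subtype.ext (Prod.ext hxy.1 hxy.2)

theorem minFac_mul_div_nsmul_eq_zero {G : Type*} [AddCommGroup G] {d : ℕ} {g : G}
    (h : addOrderOf g = d) : (d.minFac * (d / d.minFac)) • g = 0 := by
  rw [Nat.mul_div_cancel' d.minFac_dvd, ← h, addOrderOf_nsmul_eq_zero]

theorem littleCrossNumber_le_alphaFun {G : Type*} [AddCommGroup G] [Finite G] {n : ℕ}
    (hn : n ≠ 0) (hG : ∀ g : G, n • g = 0)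
    (hT : ∀ p : ℕ, p.Prime → Nat.card (AddSubgroup.torsionBy G p) ≤ p) :
    littleCrossNumber G ≤ alphaFun n := by
  refine (littleCrossNumber_le_sum_divisors hn hG (fun d => d.minFac - 1) ?_).trans_eq ?_
  · intro d hd U hU hlt
    have : Fact d.minFac.Prime := ⟨Nat.minFac_prime hd⟩
    let _ := AddSubgroup.torsionBy.zmodModule (A := G) (n := d.minFac)
    have hfr : Module.finrank (ZMod d.minFac) (AddSubgroup.torsionBy G d.minFac) ≤ 1 :=
      finrank_torsionBy_le (by simpa using hT _ (Nat.minFac_prime hd))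
    obtain ⟨T, hTU, hT0, hTc, hTs⟩ := exists_le_nsmul_sum_eq_zero (M := d.minFac)
      (fun ι v s hs => exists_short_zero_sum_of_finrank_le_one hfr v s hs) U
      (fun g hg => minFac_mul_div_nsmul_eq_zero (hU g hg)) hlt
    exact ⟨T, hTU, hT0, Or.inr ⟨hTc, hTs⟩⟩
  · refine Finset.sum_congr rfl fun d _ => ?_
    rw [Nat.cast_sub d.minFac_pos, Nat.cast_one]

/-- For composite `d`, short zero-sum subsequences over `G[p]`, with `p = P⁻(d)`, are required.
For `d` prime, a zero-sum subsequence of any length contradicts zero-sumfreeness, so `2 (p - 1)`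
replaces `3 (p - 1)`. -/
theorem littleCrossNumber_le_three_alphaFun_sub_betaFun {G : Type*} [AddCommGroup G] [Finite G]
    {n : ℕ} (hn : n ≠ 0) (hG : ∀ g : G, n • g = 0)
    (hT : ∀ p : ℕ, p.Prime → Nat.card (AddSubgroup.torsionBy G p) ≤ p ^ 2) :
    littleCrossNumber G ≤ 3 * alphaFun n - betaFun n := by
  refine (littleCrossNumber_le_sum_divisors hn hG
    (fun d => if d.Prime then 2 * (d.minFac - 1) else 3 * (d.minFac - 1)) ?_).trans_eq ?_
  · intro d hd U hU hlt
    have : Fact d.minFac.Prime := ⟨Nat.minFac_prime hd⟩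
    let _ := AddSubgroup.torsionBy.zmodModule (A := G) (n := d.minFac)
    have hfr := finrank_torsionBy_le (hT _ (Nat.minFac_prime hd))
    have hU' := fun g hg => minFac_mul_div_nsmul_eq_zero (hU g hg)
    by_cases hdp : d.Prime
    · rw [if_pos hdp] at hlt
      obtain ⟨T, hTU, hT0, -, hTs⟩ := exists_le_nsmul_sum_eq_zero (M := U.card)
        (N := 2 * (d.minFac - 1)) (p := d.minFac) (k := d / d.minFac) (fun ι v s hs => by
          obtain ⟨s', hs', hc⟩ := Finset.exists_subset_card_eq (Nat.succ_le_of_lt hs)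
          obtain ⟨t, ht, hne, hsum⟩ := exists_zero_sum_of_finrank (p := d.minFac) v s'
            ((Nat.mul_le_mul_right _ hfr).trans_lt (by omega))
          have := Finset.card_le_card ht
          exact ⟨t, ht.trans hs', hne, by omega, hsum⟩) U hU' hlt
      rw [hdp.minFac_eq, Nat.div_self hdp.pos, one_nsmul] at hTs
      exact ⟨T, hTU, hT0, Or.inl hTs⟩
    · rw [if_neg hdp] at hlt
      obtain ⟨T, hTU, hT0, hTc, hTs⟩ := exists_le_nsmul_sum_eq_zero (M := d.minFac)
        (fun ι v s hs => exists_short_zero_sum_of_finrank_le_two hfr v s hs) U hU' hlt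
      exact ⟨T, hTU, hT0, Or.inr ⟨hTc, hTs⟩⟩
  · rw [alphaFun, betaFun, Finset.mul_sum, Finset.sum_filter, ← Finset.sum_sub_distrib]
    refine Finset.sum_congr rfl fun d _ => ?_
    have := Nat.cast_sub (R := ℝ) d.minFac_pos
    split_ifs <;> push_cast [this] <;> ring

/-! ### Removing the largest prime factor -/

theorem sum_inv_pow_le {p : ℕ} (hp : 2 ≤ p) (a : ℕ) :
    ∑ i ∈ Finset.range a, (1 : ℝ) / (p : ℝ) ^ i ≤ p / (p - 1) := by
  have hp' : (2 : ℝ) ≤ p := by exact_mod_cast hp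
  have h1 : (0 : ℝ) < p - 1 := by linarith
  have key : ∑ i ∈ Finset.range a, (1 : ℝ) / (p : ℝ) ^ i = p / (p - 1) * (1 - 1 / (p : ℝ) ^ a) := by
    induction a with
    | zero => simp
    | succ a ih =>
      rw [Finset.sum_range_succ, ih]
      field_simp
      ring
  rw [key]
  have : (0 : ℝ) < 1 / (p : ℝ) ^ a := by positivity
  have h2 : (0 : ℝ) ≤ p / (p - 1) := by positivity
  nlinarith

theorem alphaFun_summand_nonneg (d : ℕ) : 0 ≤ ((d.minFac : ℝ) - 1) / (d : ℝ) := by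
  have : (1 : ℝ) ≤ d.minFac := by exact_mod_cast d.minFac_pos
  exact div_nonneg (by linarith) (Nat.cast_nonneg d)

/-- The divisors `d * p ^ i` of `m * p ^ a`, for a fixed divisor `d` of `m`: if `d ≠ 1`, their
smallest prime factor is that of `d`, and the sum is geometric; if `d = 1`, it is
`(p - 1) * ∑ i ≥ 1, 1 / p ^ i`. -/
theorem sum_minFac_mul_pow_le {m p : ℕ} (hp : p.Prime) (hlt : ∀ q, q.Prime → q ∣ m → q < p)
    (a : ℕ) {d : ℕ} (hd : d ∣ m) :
    ∑ i ∈ Finset.range (a + 1), (((d * p ^ i).minFac : ℝ) - 1) / ((d * p ^ i : ℕ) : ℝ) ≤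
      ((d.minFac : ℝ) - 1) / (d : ℝ) * (p / (p - 1)) + if d = 1 then 1 else 0 := by
  have hp' : (2 : ℝ) ≤ p := by exact_mod_cast hp.two_le
  have h1 : (0 : ℝ) < p - 1 := by linarith
  by_cases hd1 : d = 1
  · subst hd1
    rw [Finset.sum_range_succ']
    have : ∀ i ∈ Finset.range a, (((1 * p ^ (i + 1)).minFac : ℝ) - 1) / ((1 * p ^ (i + 1) : ℕ) : ℝ)
        = (p - 1) / p * (1 / (p : ℝ) ^ i) := by
      intro i _
      rw [one_mul, Nat.pow_minFac (Nat.succ_ne_zero i), hp.minFac_eq]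
      push_cast
      field_simp
      ring
    rw [Finset.sum_congr rfl this, ← Finset.mul_sum]
    have h2 := mul_le_mul_of_nonneg_left (sum_inv_pow_le hp.two_le a)
      (show (0 : ℝ) ≤ (p - 1) / p by positivity)
    rw [show ((p : ℝ) - 1) / p * (p / (p - 1)) = 1 by field_simp] at h2
    simpa using h2
  · have hmf : ∀ i, (d * p ^ i).minFac = d.minFac := by
      intro i
      refine le_antisymm (Nat.minFac_le_of_dvd (Nat.minFac_prime hd1).two_le
        ((Nat.minFac_dvd d).mul_right _)) ?_
      have hne : d * p ^ i ≠ 1 := fun h => hd1 (Nat.eq_one_of_mul_eq_one_right h)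
      have hpr := Nat.minFac_prime hne
      rcases hpr.dvd_mul.1 (Nat.minFac_dvd (d * p ^ i)) with h | h
      · exact Nat.minFac_le_of_dvd hpr.two_le h
      · rw [(Nat.prime_dvd_prime_iff_eq hpr hp).1 (hpr.dvd_of_dvd_pow h)]
        exact (hlt _ (Nat.minFac_prime hd1) ((Nat.minFac_dvd d).trans hd)).le
    have : ∀ i ∈ Finset.range (a + 1), (((d * p ^ i).minFac : ℝ) - 1) / ((d * p ^ i : ℕ) : ℝ)
        = ((d.minFac : ℝ) - 1) / (d : ℝ) * (1 / (p : ℝ) ^ i) := by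
      intro i _
      rw [hmf]
      push_cast
      rw [div_mul_div_comm, mul_one]
    rw [Finset.sum_congr rfl this, ← Finset.mul_sum, if_neg hd1, add_zero]
    exact mul_le_mul_of_nonneg_left (sum_inv_pow_le hp.two_le _) (alphaFun_summand_nonneg d)

theorem alphaFun_mul_pow_le {m p : ℕ} (hm : m ≠ 0) (hp : p.Prime)
    (hlt : ∀ q, q.Prime → q ∣ m → q < p) (a : ℕ) :
    alphaFun (m * p ^ a) ≤ alphaFun m * (p / (p - 1)) + 1 := by
  classical
  have hcop : m.Coprime (p ^ a) := by
    refine Nat.Coprime.pow_right a (Nat.Coprime.symm ?_)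
    exact (Nat.Prime.coprime_iff_not_dvd hp).2 fun h => (hlt p hp h).false
  have hdiv : (m * p ^ a).divisors =
      (m.divisors ×ˢ (Finset.range (a + 1))).image fun x => x.1 * p ^ x.2 := by
    rw [Nat.divisors_mul, Nat.divisors_prime_pow hp, Finset.mul_def]
    ext x
    simp [and_assoc]
  unfold alphaFun
  rw [hdiv]
  refine (Finset.sum_image_le_of_nonneg ?_).trans ?_
  · intro i _
    exact alphaFun_summand_nonneg _
  · rw [Finset.sum_product, Finset.sum_mul]
    calc _ ≤ ∑ d ∈ m.divisors,
          (((d.minFac : ℝ) - 1) / (d : ℝ) * (p / (p - 1)) + if d = 1 then 1 else 0) :=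
          Finset.sum_le_sum fun d hd => sum_minFac_mul_pow_le hp hlt a (Nat.dvd_of_mem_divisors hd)
      _ = _ := by
          rw [Finset.sum_add_distrib, Finset.sum_ite_eq' , if_pos (by simpa using hm)]

theorem betaFun_eq (n : ℕ) : betaFun n = ∑ p ∈ n.primeFactors, (1 - 1 / (p : ℝ)) := by
  unfold betaFun
  have : n.divisors.filter Nat.Prime = n.primeFactors := by
    ext q
    simp only [Finset.mem_filter, Nat.mem_divisors, Nat.mem_primeFactors]
    tauto
  rw [this]
  refine Finset.sum_congr rfl fun q hq => ?_
  have hq := Nat.prime_of_mem_primeFactors hq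
  have : (q : ℝ) ≠ 0 := by exact_mod_cast hq.ne_zero
  rw [hq.minFac_eq]
  field_simp

/-- The induction step on the largest prime factor: an integer with `k + 1` distinct prime
factors is `m * p ^ a`, where `m` has the other `k` prime factors, all of them less than `p`;
so `p` is at least the prime number with index `k` (counting from `0`). -/
theorem exists_eq_mul_pow_max_prime {n k : ℕ} (hn : n.primeFactors.card = k + 1) :
    ∃ m p a : ℕ, m ≠ 0 ∧ p.Prime ∧ (∀ q, q.Prime → q ∣ m → q < p) ∧ n = m * p ^ a ∧
      m.primeFactors.card = k ∧ p ∉ m.primeFactors ∧ n.primeFactors = insert p m.primeFactors ∧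
      Nat.nth Nat.Prime k ≤ p := by
  have hne : n.primeFactors.Nonempty := Finset.card_pos.1 (by omega)
  have hn0 : n ≠ 0 := by rintro rfl; simp at hn
  set p := n.primeFactors.max' hne with hpdef
  have hpm : p ∈ n.primeFactors := Finset.max'_mem _ _
  have hp := Nat.prime_of_mem_primeFactors hpm
  have hmn : n / p ^ n.factorization p * p ^ n.factorization p = n := by
    rw [mul_comm]; exact Nat.ordProj_mul_ordCompl_eq_self n p
  set m := n / p ^ n.factorization p with hmdef
  have hm0 : m ≠ 0 := by
    rintro h
    rw [h, zero_mul] at hmn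
    exact hn0 hmn.symm
  have hpm' : p ∉ m.primeFactors := fun h =>
    Nat.not_dvd_ordCompl hp hn0 (Nat.dvd_of_mem_primeFactors h)
  have ha : n.factorization p ≠ 0 := by
    have := hp.factorization_pos_of_dvd hn0 (Nat.dvd_of_mem_primeFactors hpm)
    omega
  have hins : n.primeFactors = insert p m.primeFactors := by
    conv_lhs => rw [← hmn]
    rw [Nat.primeFactors_mul hm0 (pow_ne_zero _ hp.ne_zero), Nat.primeFactors_pow _ ha,
      hp.primeFactors, Finset.union_comm, Finset.insert_eq]
  have hcard : m.primeFactors.card = k := by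
    have := Finset.card_insert_of_notMem hpm'
    rw [← hins] at this
    omega
  have hlt : ∀ q, q.Prime → q ∣ m → q < p := by
    intro q hq hqm
    have hqm' : q ∈ m.primeFactors := Nat.mem_primeFactors.2 ⟨hq, hqm, hm0⟩
    refine lt_of_le_of_ne (Finset.le_max' _ _ (hins ▸ Finset.mem_insert_of_mem hqm')) ?_
    rintro rfl
    exact hpm' hqm'
  refine ⟨m, p, n.factorization p, hm0, hp, hlt, hmn.symm, hcard, hpm', hins, ?_⟩
  refine Nat.lt_succ_iff.1 (Nat.nth_lt_of_lt_count ?_)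
  rw [Nat.count_eq_card_filter_range, ← Nat.add_one_le_iff, ← hn]
  refine Finset.card_le_card fun q hq => ?_
  have := Finset.le_max' _ _ hq
  exact Finset.mem_filter.2 ⟨Finset.mem_range.2 (by omega), Nat.prime_of_mem_primeFactors hq⟩

/-! ### Comparison with the first prime numbers -/

/-- `A_k = ∑ i < k, ∏ j ∈ (i, k), p_j / (p_j - 1)`, where `p_0 < p_1 < ⋯` are the prime numbers:
the supremum of `α(n)` over the `n` with `k` distinct prime factors. -/
noncomputable def alphaSup : ℕ → ℝ
  | 0 => 0
  | k + 1 => alphaSup k * ((Nat.nth Nat.Prime k : ℝ) / ((Nat.nth Nat.Prime k : ℝ) - 1)) + 1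

/-- The sum of the inverses of the first `k` prime numbers. -/
noncomputable def primeInvSum (k : ℕ) : ℝ :=
  ∑ i ∈ Finset.range k, 1 / (Nat.nth Nat.Prime i : ℝ)

theorem two_le_nth_prime (k : ℕ) : (2 : ℝ) ≤ Nat.nth Nat.Prime k := by
  exact_mod_cast (Nat.nth_mem_of_infinite Nat.infinite_setOfPred_prime k).two_le

theorem alphaSup_nonneg (k : ℕ) : 0 ≤ alphaSup k := by
  induction k with
  | zero => exact le_rfl
  | succ k ih =>
    have := two_le_nth_prime k
    have h1 : (0 : ℝ) < (Nat.nth Nat.Prime k : ℝ) - 1 := by linarith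
    rw [alphaSup]
    positivity

theorem alphaFun_le_alphaSup {n k : ℕ} (hn0 : n ≠ 0) (hn : n.primeFactors.card = k) :
    alphaFun n ≤ alphaSup k := by
  induction k generalizing n with
  | zero =>
    have : n = 1 := by
      rw [Finset.card_eq_zero, Nat.primeFactors_eq_empty] at hn
      omega
    subst this
    simp [alphaFun, alphaSup]
  | succ k ih =>
    obtain ⟨m, p, a, hm0, hp, hlt, rfl, hmk, -, -, hnth⟩ := exists_eq_mul_pow_max_prime hn
    refine (alphaFun_mul_pow_le hm0 hp hlt a).trans ?_
    rw [alphaSup]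
    have h2 := two_le_nth_prime k
    have h3 : (Nat.nth Nat.Prime k : ℝ) ≤ p := by exact_mod_cast hnth
    have hfrac : (p : ℝ) / (p - 1) ≤
        (Nat.nth Nat.Prime k : ℝ) / ((Nat.nth Nat.Prime k : ℝ) - 1) := by
      rw [div_le_div_iff₀ (by linarith) (by linarith)]
      nlinarith
    have := mul_le_mul (ih hm0 hmk) hfrac (div_nonneg (by linarith) (by linarith))
      (alphaSup_nonneg k)
    linarith

theorem le_betaFun {n k : ℕ} (hn : n.primeFactors.card = k) :
    (k : ℝ) - primeInvSum k ≤ betaFun n := by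
  rw [betaFun_eq]
  induction k generalizing n with
  | zero =>
    rw [Finset.card_eq_zero.1 hn]
    simp [primeInvSum]
  | succ k ih =>
    obtain ⟨m, p, a, -, hp, -, -, hmk, hpm, hins, hnth⟩ := exists_eq_mul_pow_max_prime hn
    rw [hins, Finset.sum_insert hpm]
    have h1 := ih hmk
    have h2 := two_le_nth_prime k
    have h3 : (Nat.nth Nat.Prime k : ℝ) ≤ p := by exact_mod_cast hnth
    have h4 : (1 : ℝ) / p ≤ 1 / (Nat.nth Nat.Prime k : ℝ) :=
      one_div_le_one_div_of_le (by linarith) h3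
    rw [primeInvSum, Finset.sum_range_succ, ← primeInvSum]
    push_cast
    linarith

theorem nth_prime_add_six_le {k : ℕ} (hk : 3 < Nat.nth Nat.Prime k) :
    Nat.nth Nat.Prime k + 6 ≤ Nat.nth Nat.Prime (k + 2) := by
  have hinf := Nat.infinite_setOfPred_prime
  have h01 : Nat.nth Nat.Prime k < Nat.nth Nat.Prime (k + 1) :=
    Nat.nth_strictMono hinf (show k < k + 1 by omega)
  have h12 : Nat.nth Nat.Prime (k + 1) < Nat.nth Nat.Prime (k + 2) :=
    Nat.nth_strictMono hinf (show k + 1 < k + 2 by omega)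
  have hmod : ∀ q : ℕ, q.Prime → 3 < q → q % 6 = 1 ∨ q % 6 = 5 := by
    intro q hq hq3
    have h2 := hq.eq_two_or_odd.resolve_left (by omega)
    have h3 : q % 3 ≠ 0 := fun h => by
      have := (Nat.prime_dvd_prime_iff_eq Nat.prime_three hq).1 (Nat.dvd_of_mod_eq_zero h)
      omega
    omega
  have h0 := hmod (Nat.nth Nat.Prime k) (Nat.nth_mem_of_infinite hinf k) hk
  have h1 := hmod (Nat.nth Nat.Prime (k + 1)) (Nat.nth_mem_of_infinite hinf (k + 1)) (by omega)
  have h2 := hmod (Nat.nth Nat.Prime (k + 2)) (Nat.nth_mem_of_infinite hinf (k + 2)) (by omega)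
  omega

theorem nth_prime_eq {p k : ℕ} (hp : p.Prime) (hk : Nat.count Nat.Prime p = k) :
    Nat.nth Nat.Prime k = p :=
  hk ▸ Nat.nth_count hp

theorem nth_prime_first :
    Nat.nth Nat.Prime 0 = 2 ∧ Nat.nth Nat.Prime 1 = 3 ∧ Nat.nth Nat.Prime 2 = 5 ∧
    Nat.nth Nat.Prime 3 = 7 ∧ Nat.nth Nat.Prime 4 = 11 ∧ Nat.nth Nat.Prime 5 = 13 ∧
    Nat.nth Nat.Prime 6 = 17 ∧ Nat.nth Nat.Prime 7 = 19 ∧ Nat.nth Nat.Prime 8 = 23 ∧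
    Nat.nth Nat.Prime 9 = 29 ∧ Nat.nth Nat.Prime 10 = 31 := by
  refine ⟨?_, ?_, ?_, ?_, ?_, ?_, ?_, ?_, ?_, ?_, ?_⟩ <;>
    exact nth_prime_eq (by norm_num) (by decide)

/-- The numbers prime to `6` have density `1 / 3`, so the prime numbers grow by at least `3`
on average. The slope `291 / 100` is at least `1 / (1 - 1 / d₁)`, as the induction for
`alphaSup_le` requires. -/
theorem le_nth_prime {k : ℕ} (hk : 9 ≤ k) :
    (291 / 100 : ℝ) * k + 1 ≤ Nat.nth Nat.Prime k := by
  obtain ⟨-, -, -, -, -, -, -, -, -, h9, h10⟩ := nth_prime_first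
  induction k using Nat.strong_induction_on with
  | _ k ih =>
    rcases Nat.lt_or_ge k 11 with h | h
    · interval_cases k
      · rw [h9]; norm_num
      · rw [h10]; norm_num
    · obtain ⟨j, rfl⟩ : ∃ j, k = j + 2 := ⟨k - 2, by omega⟩
      have h1 := ih j (by omega) (by omega)
      have hj : (9 : ℝ) ≤ j := by exact_mod_cast (show 9 ≤ j by omega)
      have h3 : 3 < Nat.nth Nat.Prime j := by
        have : (3 : ℝ) < Nat.nth Nat.Prime j := by linarith
        exact_mod_cast this
      have h6 : ((Nat.nth Nat.Prime j + 6 : ℕ) : ℝ) ≤ Nat.nth Nat.Prime (j + 2) := by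
        exact_mod_cast nth_prime_add_six_le h3
      push_cast at h6 ⊢
      linarith

/-- The ratio `A_k / k` is maximal at `k = 9`, with value `d₁`. -/
theorem alphaSup_le (k : ℕ) : alphaSup k ≤ (166822111 / 109486080 : ℝ) * k := by
  obtain ⟨h0, h1, h2, h3, h4, h5, h6, h7, h8, -, -⟩ := nth_prime_first
  rcases Nat.lt_or_ge k 9 with hk | hk
  · interval_cases k <;> norm_num [alphaSup, h0, h1, h2, h3, h4, h5, h6, h7, h8]
  · induction k, hk using Nat.le_induction with
    | base => norm_num [alphaSup, h0, h1, h2, h3, h4, h5, h6, h7, h8]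
    | succ k hk ih =>
      have hp := le_nth_prime hk
      have hk' : (9 : ℝ) ≤ k := by exact_mod_cast hk
      rw [alphaSup]
      set P : ℝ := (Nat.nth Nat.Prime k : ℝ)
      have hP : 0 < P - 1 := by linarith
      have e : P / (P - 1) = 1 + 1 / (P - 1) := by field_simp; ring
      have hfrac : alphaSup k * (1 / (P - 1)) ≤ (166822111 / 109486080 : ℝ) * (100 / 291) := by
        rw [mul_one_div, div_le_iff₀ hP]
        linarith
      rw [e]
      push_cast
      linarith

/-- The ratio `(3 A_k - k + ∑ i < k, 1 / p_i) / k` is maximal at `k = 8`, with value `d₂`. -/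
theorem three_alphaSup_le (k : ℕ) :
    3 * alphaSup k - (k - primeInvSum k) ≤ (1784073894563 / 476759162880 : ℝ) * k := by
  obtain ⟨h0, h1, h2, h3, h4, h5, h6, h7, h8, -, -⟩ := nth_prime_first
  rcases Nat.lt_or_ge k 9 with hk | hk
  · interval_cases k <;>
      norm_num [alphaSup, primeInvSum, Finset.sum_range_succ, h0, h1, h2, h3, h4, h5, h6, h7, h8]
  · induction k, hk using Nat.le_induction with
    | base =>
      norm_num [alphaSup, primeInvSum, Finset.sum_range_succ, h0, h1, h2, h3, h4, h5, h6, h7, h8]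
    | succ k hk ih =>
      have hp := le_nth_prime hk
      have hA := alphaSup_le k
      have hk' : (9 : ℝ) ≤ k := by exact_mod_cast hk
      rw [alphaSup, primeInvSum, Finset.sum_range_succ, ← primeInvSum]
      set P : ℝ := (Nat.nth Nat.Prime k : ℝ)
      have hP : 0 < P - 1 := by linarith
      have e : P / (P - 1) = 1 + 1 / (P - 1) := by field_simp; ring
      have hfrac : alphaSup k * (1 / (P - 1)) ≤ (166822111 / 109486080 : ℝ) * (100 / 291) := by
        rw [mul_one_div, div_le_iff₀ hP]
        linarith
      have hinv : 1 / P ≤ 1 / 23 := one_div_le_one_div_of_le (by norm_num) (by linarith)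
      rw [e]
      push_cast
      linarith

theorem card_primeFactors_eq_cardDistinctFactors (n : ℕ) :
    n.primeFactors.card = ArithmeticFunction.cardDistinctFactors n := rfl

theorem alphaFun_le {n : ℕ} (hn : n ≠ 0) : alphaFun n ≤
    (166822111 / 109486080 : ℝ) * (ArithmeticFunction.cardDistinctFactors n : ℝ) :=
  (alphaFun_le_alphaSup hn (card_primeFactors_eq_cardDistinctFactors n)).trans (alphaSup_le _)

theorem three_alphaFun_sub_betaFun_le {n : ℕ} (hn : n ≠ 0) : 3 * alphaFun n - betaFun n ≤
    (1784073894563 / 476759162880 : ℝ) * (ArithmeticFunction.cardDistinctFactors n : ℝ) := by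
  have h1 := alphaFun_le_alphaSup hn (card_primeFactors_eq_cardDistinctFactors n)
  have h2 := le_betaFun (card_primeFactors_eq_cardDistinctFactors n)
  have h3 := three_alphaSup_le (ArithmeticFunction.cardDistinctFactors n)
  linarith

/-! ### The bounds for groups of rank at most two -/

theorem proposition2p2 {G : Type*} [AddCommGroup G] :
    (∀ n : ℕ, 0 < n → Nonempty (G ≃+ ZMod n) →
      littleCrossNumber G ≤ alphaFun n ∧
        alphaFun n ≤ (166822111 / 109486080 : ℝ) * (ArithmeticFunction.cardDistinctFactors n : ℝ)) ∧
    (∀ m n : ℕ, 1 < m → 0 < n → m ∣ n → Nonempty (G ≃+ ZMod m × ZMod n) →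
      littleCrossNumber G ≤ 3 * alphaFun n - betaFun n ∧
        3 * alphaFun n - betaFun n ≤
          (1784073894563 / 476759162880 : ℝ) *
            (ArithmeticFunction.cardDistinctFactors n : ℝ)) := by
  refine ⟨?_, ?_⟩
  · rintro n hn ⟨e⟩
    have : NeZero n := ⟨hn.ne'⟩
    have : Finite G := Finite.of_equiv _ e.toEquiv.symm
    refine ⟨littleCrossNumber_le_alphaFun hn.ne' (fun g => ?_) fun p hp => ?_, alphaFun_le hn.ne'⟩
    · rw [← e.map_eq_zero_iff, map_nsmul]
      simp
    · exact (card_torsionBy_le_of_injective e.toAddMonoidHom e.injective p).trans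
        (card_torsionBy_zmod_le hn.ne' hp.ne_zero)
  · rintro m n hm hn hmn ⟨e⟩
    have : NeZero n := ⟨hn.ne'⟩
    have : NeZero m := ⟨(zero_lt_one.trans hm).ne'⟩
    have : Finite G := Finite.of_equiv _ e.toEquiv.symm
    refine ⟨littleCrossNumber_le_three_alphaFun_sub_betaFun hn.ne' (fun g => ?_) fun p hp => ?_,
      three_alphaFun_sub_betaFun_le hn.ne'⟩
    · rw [← e.map_eq_zero_iff, map_nsmul]
      obtain ⟨c, rfl⟩ := hmn
      refine Prod.ext ?_ ?_
      · rw [Prod.smul_fst, mul_nsmul]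
        simp
      · rw [Prod.smul_snd]
        simp
    · rw [sq]
      exact (card_torsionBy_le_of_injective e.toAddMonoidHom e.injective p).trans
        ((card_torsionBy_prod_le p).trans (Nat.mul_le_mul
          (card_torsionBy_zmod_le (NeZero.ne m) hp.ne_zero)
          (card_torsionBy_zmod_le hn.ne' hp.ne_zero)))
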